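/- Let $\mathcal{X}$ be a linear vector field on $\mathrm{SL}(2,\mathbb{R})$, i.e. a smooth vector field whose flow $(\varphi_t)_{t\in\mathbb{R}}$ is a family of Lie group automorphisms of $\mathrm{SL}(2,\mathbb{R})$. Identify $\mathfrak{sl}(2,\mathbb{R})$ with the right-invariant vector fields on $\mathrm{SL}(2,\mathbb{R})$ by evaluation at the identity, and let $$Y=\begin{pmatrix}0&-1\\1&0\end{pmatrix},\quad H=\begin{pmatrix}1&0\\0&-1\end{pmatrix},\quad Z=\begin{pmatrix}0&1\\0&0\end{pmatrix}$$ be the basis of $\mathfrak{sl}(2,\mathbb{R})$ adapted to its Iwasawa decomposition. Then there is exactly one right-invariant vector field $X=aY+bH+cZ$ ($a,b,c\in\mathbb{R}$) associated with $\mathcal{X}$, in the sense that the derivation $\mathcal{D}(W)=-[\mathcal{X},W]$ satisfies $\mathcal{D}(W)=-[X,W]$ for every right-invariant vector field $W$. For this $X$: 1. the complex eigenvalues of the linear map $-\operatorname{ad}(X)$ on $\mathfrak{sl}(2,\mathbb{R})$ are $0$ and $\pm2\sqrt{b^2+ac-a^2}$; 2. if $a^2>ac+b^2$, then every orbit of $\varphi_t$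 that is not a fixed point is periodic: for each $g$ with $\varphi_t(g)\neq g$ for some $t$, there is $T>0$ with $\varphi_{t+T}(g)=\varphi_t(g)$ for all $t\in\mathbb{R}$. -/

import Mathlib

open scoped ContDiff TensorProduct Matrix.Norms.Operator

attribute [local instance 100] LieRing.ofAssociativeRing

namespace SL2Linear

/-- The ambient space of real `2 × 2` matrices. -/
abbrev Mat2 : Type := Matrix (Fin 2) (Fin 2) ℝ

/-- The group `SL(2, ℝ)`. -/
abbrev SL2 : Type := Matrix.SpecialLinearGroup (Fin 2) ℝ

/-- The Lie algebra `sl(2, ℝ)` of trace zero matrices, with the commutator as bracket. -/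
abbrev sl2 : LieSubalgebra ℝ (Matrix (Fin 2) (Fin 2) ℝ) :=
  LieAlgebra.SpecialLinear.sl (Fin 2) ℝ

/-- `SL(2, ℝ)` as a closed embedded submanifold of the space of matrices. -/
def carrier : Set Mat2 := {A | A.det = 1}

/-- Extension by zero of a map on `SL(2, ℝ)` to the ambient space. Only its values on the
submanifold `carrier` matter below. -/
noncomputable def ext (f : SL2 → Mat2) : Mat2 → Mat2 :=
  Function.extend Subtype.val f 0

/-- Smoothness of a map from the embedded submanifold `SL(2, ℝ)` to the space of matrices. -/
def IsSmooth (f : SL2 → Mat2) : Prop := ContDiffOn ℝ ∞ (ext f) carrier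

/-- The tangent space of the submanifold `SL(2, ℝ)` at `g`, which is `g · sl(2, ℝ)`, the kernel of
the differential of the determinant at `g`. -/
def tangentSpace (g : SL2) : Submodule ℝ Mat2 :=
  sl2.toSubmodule.comap (LinearMap.mulLeft ℝ (g⁻¹).val)

/-- Smooth vector fields on `SL(2, ℝ)`; tangent vectors are viewed as matrices. -/
def IsVectorField (F : SL2 → Mat2) : Prop :=
  IsSmooth F ∧ ∀ g, F g ∈ tangentSpace g

/-- The Lie bracket of two vector fields on the submanifold `SL(2, ℝ)`:
`[F, G](g) = dG_g (F g) - dF_g (G g)`. Derivatives within `carrier` at `g` are determined on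
the tangent space at `g`, so this does not depend on any choice when `F`, `G` are vector fields. -/
noncomputable def bracket (F G : SL2 → Mat2) (g : SL2) : Mat2 :=
  VectorField.lieBracketWithin ℝ (ext F) (ext G) carrier g.val

/-- `φ` is the (global) flow of the vector field `F`: `φ 0 = id` and `d/dt φ_t(g) = F (φ_t(g))`. -/
def IsFlow (F : SL2 → Mat2) (φ : ℝ → SL2 → SL2) : Prop :=
  (∀ g, φ 0 g = g) ∧
    ∀ g t, HasDerivAt (fun s => (φ s g).val) (F (φ t g)) t

/-- Automorphisms of the Lie group `SL(2, ℝ)`: group automorphisms that are smooth together with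
their inverse. -/
def IsLieAut (f : SL2 → SL2) : Prop :=
  ∃ e : SL2 ≃* SL2, (∀ g, e g = f g) ∧
    IsSmooth (fun g => (e g).val) ∧ IsSmooth (fun g => (e.symm g).val)

/-- Linear vector fields: the flow is a family of automorphisms of the Lie group. -/
def IsLinearVectorField (F : SL2 → Mat2) : Prop :=
  IsVectorField F ∧ ∃ φ, IsFlow F φ ∧ ∀ t, IsLieAut (φ t)

/-- The right-invariant vector field with value `X` at the identity. -/
def rightInv (X : sl2) : SL2 → Mat2 := fun g => X.val * g.val

/-- The derivation associated with a linear vector field `F`, acting on the right-invariant vector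
field with value `W` at the identity: `𝒟(W) = -[F, W]`. -/
noncomputable def derivation (F : SL2 → Mat2) (W : sl2) : SL2 → Mat2 :=
  fun g => -bracket F (rightInv W) g

/-- `X` is the right-invariant vector field associated with the linear vector field `F`: the
derivation of `F` is `-ad(X)` on the Lie algebra of right-invariant vector fields. -/
def IsAssociated (F : SL2 → Mat2) (X : sl2) : Prop :=
  ∀ (W : sl2) (g : SL2), derivation F W g = -bracket (rightInv X) (rightInv W) g

/-- The generator `Y` of the compact part. -/
def Y : sl2 := ⟨!![0, -1; 1, 0], by
  refine LinearMap.mem_ker.2 ?_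
  simp [Matrix.trace_fin_two]⟩

/-- The generator `H` of the abelian part. -/
def H : sl2 := ⟨!![1, 0; 0, -1], by
  refine LinearMap.mem_ker.2 ?_
  simp [Matrix.trace_fin_two]⟩

/-- The generator `Z` of the nilpotent part. -/
def Z : sl2 := ⟨!![0, 1; 0, 0], by
  refine LinearMap.mem_ker.2 ?_
  simp [Matrix.trace_fin_two]⟩

/-- `μ` is a complex eigenvalue of the real endomorphism `D` of `sl(2, ℝ)`, that is, an eigenvalue
of its complexification. -/
def IsComplexEigenvalue (D : Module.End ℝ sl2) (μ : ℂ) : Prop :=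
  Module.End.HasEigenvalue (LinearMap.baseChange ℂ D) μ

end SL2Linear

namespace SL2Linear

/-! ### Smooth maps along curves -/

/-! Differentiating the multiplicativity of the flow at time `0` gives the cocycle identity `F (g *
h) = F g * h + g * F h`. Hence the differential `D` of `F` at the identity is a derivation of `sl2`,
and `derivation F W` is the right-invariant field with value `D W`. Derivations of `sl2` are inner
(`exists_forall_eq_commutator`) and its centre is trivial, so `D = [X, ·]` for exactly one `X`. A
cocycle on `SL2` is determined by its differential at `1`, because the unipotent one-parameter
subgroups generate the group. Therefore `F g = X * g - g * X` (`IsAssociated.eq_commutator`), and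
orbits solve a linear equation whose solutions are conjugation by `exp (t X)`. Since `X * X = (b² +
ac - a²) • 1`, a negative scalar `-θ²` makes `exp (t X)` a combination of `cos (θ t)` and `sin (θ
t)`, with period `2π / θ`. The eigenvalues come from the characteristic polynomial `x³ - 4 (b² + ac
- a²) x`. -/

lemma val_mem_carrier (g : SL2) : g.val ∈ carrier := g.2

lemma ext_val (f : SL2 → Mat2) (g : SL2) : ext f g.val = f g :=
  Subtype.val_injective.extend_apply f 0 g

/-- The differential at `g` of a map defined on `SL(2, ℝ)`. -/
noncomputable def differential (f : SL2 → Mat2) (g : SL2) : Mat2 →L[ℝ] Mat2 :=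
  fderivWithin ℝ (ext f) carrier g.val

/-- The main computing tool: a derivative within `carrier` is meaningful only on tangent vectors, so
it is evaluated along curves in the group and compared by uniqueness of derivatives. -/
lemma IsSmooth.hasDerivAt_comp {f : SL2 → Mat2} (hf : IsSmooth f) {γ : ℝ → SL2} {v : Mat2} {t : ℝ}
    (hγ : HasDerivAt (fun s => (γ s).val) v t) :
    HasDerivAt (fun s => f (γ s)) (differential f (γ t) v) t := by
  have hd : HasFDerivWithinAt (ext f) (differential f (γ t)) carrier (γ t).val :=
    ((hf.differentiableOn (by simp)) _ (val_mem_carrier _)).hasFDerivWithinAt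
  have h := hd.comp_hasDerivAt (f := fun s => (γ s).val) t hγ
    (Filter.Eventually.of_forall fun s => val_mem_carrier _)
  exact h.congr_of_eventuallyEq (Filter.Eventually.of_forall fun s => (ext_val f (γ s)).symm)

lemma isSmooth_rightInv (W : sl2) : IsSmooth (rightInv W) := by
  have h : ContDiffOn ℝ ∞ (fun A : Mat2 => W.val * A) carrier :=
    (contDiff_const.mul contDiff_id).contDiffOn
  refine h.congr fun A hA => ?_
  exact ext_val (rightInv W) ⟨A, hA⟩

lemma bracket_apply (F G : SL2 → Mat2) (g : SL2) :
    bracket F G g = differential G g (F g) - differential F g (G g) := by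
  simp only [bracket, VectorField.lieBracketWithin, ext_val]
  rfl

/-! ### Curves in `SL(2, ℝ)` -/

lemma mem_sl2_iff {A : Mat2} : A ∈ sl2 ↔ A.trace = 0 := Iff.rfl

lemma trace_val (W : sl2) : W.val.trace = 0 := mem_sl2_iff.1 W.2

lemma sl2_apply_one_one (W : sl2) : W.val 1 1 = -W.val 0 0 := by
  have := trace_val W
  rw [Matrix.trace_fin_two] at this
  linarith

/-- A curve through the identity with velocity `W`. -/
noncomputable def curve (W : sl2) (s : ℝ) : SL2 :=
  -- The product of an upper unipotent, a lower unipotent and a diagonal matrix, one factor for each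
  -- coordinate of `W`.
  ⟨!![(1 + s * W.val 0 1 * (s * W.val 1 0)) * Real.exp (s * W.val 0 0),
      s * W.val 0 1 * Real.exp (-(s * W.val 0 0));
      s * W.val 1 0 * Real.exp (s * W.val 0 0), Real.exp (-(s * W.val 0 0))], by
    rw [Matrix.det_fin_two_of]
    have h : Real.exp (s * W.val 0 0) * Real.exp (-(s * W.val 0 0)) = 1 := by
      rw [← Real.exp_add]; simp
    linear_combination h⟩

lemma curve_zero (W : sl2) : curve W 0 = 1 := by
  ext i j
  fin_cases i <;> fin_cases j <;> simp [curve]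

lemma hasDerivAt_matrix {A : ℝ → Mat2} {A' : Mat2} {t : ℝ}
    (h : ∀ i j, HasDerivAt (fun s => A s i j) (A' i j) t) : HasDerivAt A A' t :=
  hasDerivAt_pi.2 fun i => hasDerivAt_pi.2 fun j => h i j

lemma hasDerivAt_apply {A : ℝ → Mat2} {A' : Mat2} {t : ℝ} (h : HasDerivAt A A' t)
    (i j : Fin 2) : HasDerivAt (fun s => A s i j) (A' i j) t :=
  hasDerivAt_pi.1 (hasDerivAt_pi.1 h i) j

lemma hasDerivAt_curve (W : sl2) : HasDerivAt (fun s => (curve W s).val) W.val 0 := by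
  have hs (r : ℝ) : HasDerivAt (fun s : ℝ => s * r) r 0 := by
    simpa using (hasDerivAt_id (0 : ℝ)).mul_const r
  have he (r : ℝ) : HasDerivAt (fun s : ℝ => Real.exp (s * r)) r 0 := by
    simpa using (hs r).exp
  have he' (r : ℝ) : HasDerivAt (fun s : ℝ => Real.exp (-(s * r))) (-r) 0 := by
    simpa using (hs r).neg.exp
  refine hasDerivAt_matrix fun i j => ?_
  fin_cases i <;> fin_cases j
  · exact ((((hs (W.val 0 1)).mul (hs (W.val 1 0))).const_add 1).mul
      (he (W.val 0 0))).congr_deriv (by simp)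
  · exact ((hs (W.val 0 1)).mul (he' (W.val 0 0))).congr_deriv (by simp)
  · exact ((hs (W.val 1 0)).mul (he (W.val 0 0))).congr_deriv (by simp)
  · simpa [curve, sl2_apply_one_one] using he' (W.val 0 0)

lemma val_inv (g : SL2) : (g⁻¹).val = g.val.trace • (1 : Mat2) - g.val := by
  ext i j
  fin_cases i <;> fin_cases j <;>
    simp [Matrix.SpecialLinearGroup.coe_inv, Matrix.adjugate_fin_two, Matrix.trace_fin_two]

lemma hasDerivAt_mul {A B : ℝ → Mat2} {A' B' : Mat2} {t : ℝ} (hA : HasDerivAt A A' t)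
    (hB : HasDerivAt B B' t) : HasDerivAt (fun s => A s * B s) (A' * B t + A t * B') t :=
  HasDerivAt.mul hA hB

lemma hasDerivAt_mul_const {A : ℝ → Mat2} {A' : Mat2} {t : ℝ} (hA : HasDerivAt A A' t)
    (B : Mat2) : HasDerivAt (fun s => A s * B) (A' * B) t :=
  HasDerivAt.mul_const hA B

lemma hasDerivAt_const_mul {A : ℝ → Mat2} {A' : Mat2} {t : ℝ} (B : Mat2)
    (hA : HasDerivAt A A' t) : HasDerivAt (fun s => B * A s) (B * A') t :=
  HasDerivAt.const_mul B hA

lemma hasDerivAt_add {A B : ℝ → Mat2} {A' B' : Mat2} {t : ℝ} (hA : HasDerivAt A A' t)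
    (hB : HasDerivAt B B' t) : HasDerivAt (fun s => A s + B s) (A' + B') t :=
  HasDerivAt.add hA hB

lemma hasDerivAt_trace {A : ℝ → Mat2} {A' : Mat2} {t : ℝ} (h : HasDerivAt A A' t) :
    HasDerivAt (fun s => (A s).trace) A'.trace t := by
  simp only [Matrix.trace_fin_two]
  exact (hasDerivAt_apply h 0 0).add (hasDerivAt_apply h 1 1)

lemma hasDerivAt_inv {γ : ℝ → SL2} {v : Mat2} {t : ℝ}
    (hγ : HasDerivAt (fun s => (γ s).val) v t) :
    HasDerivAt (fun s => ((γ s)⁻¹).val) (v.trace • (1 : Mat2) - v) t := by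
  simp only [val_inv]
  exact ((hasDerivAt_trace hγ).smul_const (1 : Mat2)).sub hγ

lemma hasDerivAt_curve_inv (W : sl2) : HasDerivAt (fun s => ((curve W s)⁻¹).val) (-W.val) 0 := by
  simpa [trace_val] using hasDerivAt_inv (hasDerivAt_curve W)

lemma hasDerivAt_curve_mul (W : sl2) (g : SL2) :
    HasDerivAt (fun s => (curve W s * g).val) (W.val * g.val) 0 := by
  exact hasDerivAt_mul_const (hasDerivAt_curve W) g.val

/-! ### Infinitesimal automorphisms -/

/-- The infinitesimal form of the multiplicativity of a flow. -/
def IsMultiplicative (F : SL2 → Mat2) : Prop :=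
  ∀ g h : SL2, F (g * h) = F g * h.val + g.val * F h

lemma IsFlow.hasDerivAt_zero {F : SL2 → Mat2} {φ : ℝ → SL2 → SL2} (hφ : IsFlow F φ) (g : SL2) :
    HasDerivAt (fun s => (φ s g).val) (F g) 0 := by
  simpa [hφ.1 g] using hφ.2 g 0

lemma IsLinearVectorField.isMultiplicative {F : SL2 → Mat2} (hF : IsLinearVectorField F) :
    IsMultiplicative F := by
  obtain ⟨-, φ, hφ, haut⟩ := hF
  intro g h
  have hmul (s : ℝ) : (φ s (g * h)).val = (φ s g).val * (φ s h).val := by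
    obtain ⟨e, he, -⟩ := haut s
    rw [← he, ← he, ← he, map_mul]
    rfl
  have h1 := hφ.hasDerivAt_zero (g * h)
  simp only [hmul] at h1
  have h2 := hasDerivAt_mul (hφ.hasDerivAt_zero g) (hφ.hasDerivAt_zero h)
  simpa [hφ.1] using h1.unique h2

namespace IsMultiplicative

variable {F : SL2 → Mat2}

lemma apply_one (hF : IsMultiplicative F) : F 1 = 0 := by
  simpa using hF 1 1

lemma apply_conj (hF : IsMultiplicative F) (g h : SL2) :
    F (g * h * g⁻¹) =
      (F g * h.val + g.val * F h) * (g⁻¹).val + g.val * h.val * F g⁻¹ := by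
  rw [hF, hF]
  simp

lemma differential_mul (hF : IsMultiplicative F) (hs : IsSmooth F) (W : sl2) (g : SL2) :
    differential F g (W.val * g.val) = differential F 1 W.val * g.val + W.val * F g := by
  have h1 := hs.hasDerivAt_comp (hasDerivAt_curve_mul W g)
  have h3 := hasDerivAt_add (hasDerivAt_mul_const (hs.hasDerivAt_comp (hasDerivAt_curve W)) g.val)
    (hasDerivAt_mul_const (hasDerivAt_curve W) (F g))
  simp only [hF (curve W _) g] at h1
  simpa [curve_zero] using h1.unique h3

/-- Tangency says that `g⁻¹ * F g` has trace zero; differentiate this along a curve through `1`,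
where `F` vanishes. -/
lemma differential_one_mem (hF : IsMultiplicative F) (hv : IsVectorField F) (W : sl2) :
    differential F 1 W.val ∈ sl2 := by
  have h1 := hasDerivAt_trace
    (hasDerivAt_mul (hasDerivAt_curve_inv W) (hv.1.hasDerivAt_comp (hasDerivAt_curve W)))
  have h2 : (fun s => (((curve W s)⁻¹).val * F (curve W s)).trace) = fun _ => 0 :=
    funext fun s => mem_sl2_iff.1 (hv.2 (curve W s))
  rw [mem_sl2_iff]
  have h3 := h1.unique (h2 ▸ hasDerivAt_const (0 : ℝ) (0 : ℝ))
  simpa [curve_zero, hF.apply_one] using h3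

lemma differential_one_conj (hF : IsMultiplicative F) (hs : IsSmooth F) (W : sl2) (g : SL2) :
    differential F 1 (g.val * W.val * (g⁻¹).val) =
      (F g * W.val + g.val * differential F 1 W.val) * (g⁻¹).val + g.val * W.val * F g⁻¹ := by
  have hc : HasDerivAt (fun s => (g * curve W s * g⁻¹).val) (g.val * W.val * (g⁻¹).val) 0 := by
    exact hasDerivAt_mul_const (hasDerivAt_const_mul g.val (hasDerivAt_curve W)) (g⁻¹).val
  have h1 := hs.hasDerivAt_comp hc
  simp only [hF.apply_conj] at h1
  have hW := hasDerivAt_curve W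
  have h2 := hasDerivAt_add (hasDerivAt_mul_const (hasDerivAt_add (hasDerivAt_const_mul (F g) hW)
    (hasDerivAt_const_mul g.val (hs.hasDerivAt_comp hW))) (g⁻¹).val)
    (hasDerivAt_mul_const (hasDerivAt_const_mul g.val hW) (F g⁻¹))
  simpa [curve_zero] using h1.unique h2

/-- The Leibniz rule: differentiate `differential_one_conj` once more, letting the conjugating
element run through `curve V`. -/
lemma differential_one_commutator (hF : IsMultiplicative F) (hs : IsSmooth F) (V W : sl2) :
    differential F 1 (V.val * W.val - W.val * V.val) =
      (differential F 1 V.val * W.val - W.val * differential F 1 V.val) +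
        (V.val * differential F 1 W.val - differential F 1 W.val * V.val) := by
  have hV := hasDerivAt_curve V
  have hV' := hasDerivAt_curve_inv V
  have hFV := hs.hasDerivAt_comp hV
  have hFV' := hs.hasDerivAt_comp hV'
  have h1 : HasDerivAt
      (fun s => differential F 1 ((curve V s).val * W.val * ((curve V s)⁻¹).val)) _ 0 :=
    (differential F 1).hasFDerivAt.comp_hasDerivAt (0 : ℝ)
      (hasDerivAt_mul (hasDerivAt_mul_const hV W.val) hV')
  simp only [hF.differential_one_conj hs W] at h1
  have h2 := hasDerivAt_add (hasDerivAt_mul (hasDerivAt_add (hasDerivAt_mul_const hFV W.val)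
    (hasDerivAt_mul_const hV (differential F 1 W.val))) hV')
    (hasDerivAt_mul (hasDerivAt_mul_const hV W.val) hFV')
  have h3 := h1.unique h2
  simp only [curve_zero, hF.apply_one, inv_one, Matrix.SpecialLinearGroup.coe_one, mul_one,
    one_mul, mul_neg, zero_mul, mul_zero, zero_add, map_neg, ← sub_eq_add_neg] at h3
  refine h3.trans ?_
  abel

end IsMultiplicative


/-! ### Derivations of `sl(2, ℝ)` are inner -/

lemma val_Y : Y.val = !![0, -1; 1, 0] := rfl

lemma val_H : H.val = !![1, 0; 0, -1] := rfl

lemma val_Z : Z.val = !![0, 1; 0, 0] := rfl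

lemma val_combination (a b c : ℝ) : (a • Y + b • H + c • Z).val = !![b, c - a; a, -b] := by
  change a • Y.val + b • H.val + c • Z.val = _
  rw [val_Y, val_H, val_Z]
  ext i j
  fin_cases i <;> fin_cases j <;> simp
  ring

lemma eq_combination (W : sl2) :
    W = W.val 1 0 • Y + W.val 0 0 • H + (W.val 0 1 + W.val 1 0) • Z := by
  apply Subtype.ext
  rw [val_combination]
  ext i j
  fin_cases i <;> fin_cases j <;> simp [sl2_apply_one_one]

lemma exists_forall_eq_commutator (D : Mat2 →ₗ[ℝ] Mat2) (hmem : ∀ W : sl2, D W.val ∈ sl2)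
    (hD : ∀ V W : sl2, D (V.val * W.val - W.val * V.val) =
      (D V.val * W.val - W.val * D V.val) + (V.val * D W.val - D W.val * V.val)) :
    ∃ X : sl2, ∀ W : sl2, D W.val = X.val * W.val - W.val * X.val := by
  have htr (W : sl2) : D W.val 1 1 = -D W.val 0 0 := sl2_apply_one_one ⟨_, hmem W⟩
  have hH := htr H
  have hY := htr Y
  have hZ := htr Z
  have e1 : H.val * Z.val - Z.val * H.val = (2 : ℝ) • Z.val := by
    rw [val_H, val_Z]; ext i j; fin_cases i <;> fin_cases j <;> simp; norm_num
  have e2 : H.val * Y.val - Y.val * H.val = (-2 : ℝ) • Y.val + (-4 : ℝ) • Z.val := by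
    rw [val_H, val_Z, val_Y]; ext i j; fin_cases i <;> fin_cases j <;> simp <;> norm_num
  have e3 : Y.val * Z.val - Z.val * Y.val = (-1 : ℝ) • H.val := by
    rw [val_H, val_Z, val_Y]; ext i j; fin_cases i <;> fin_cases j <;> simp
  have h1 := hD H Z
  have h2 := hD H Y
  have h3 := hD Y Z
  rw [e1, map_smul] at h1
  rw [e3, map_smul] at h3
  rw [e2, map_add, map_smul, map_smul] at h2
  -- Read off from `[X, H]`, whose off-diagonal entries are `-2 * X 0 1` and `2 * X 1 0`, and from
  -- `[X, Z]`, whose upper right entry is `2 * X 0 0`.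
  refine ⟨(D H.val 1 0 / 2) • Y + (D Z.val 0 1 / 2) • H +
    (D H.val 1 0 / 2 - D H.val 0 1 / 2) • Z, ?_⟩
  rw [val_combination]
  -- With `A`, `B`, `C` standing for `D H`, `D Y`, `D Z`, the Leibniz rule on the three basis
  -- brackets is a linear system that leaves three free parameters, those of `X`.
  have key (a b c : ℝ) (A B C : Mat2) (hA : A 1 1 = -A 0 0) (hB : B 1 1 = -B 0 0)
      (hC : C 1 1 = -C 0 0)
      (h1 : (2 : ℝ) • C = (A * Z.val - Z.val * A) + (H.val * C - C * H.val))
      (h2 : (-2 : ℝ) • B + (-4 : ℝ) • C =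
        (A * Y.val - Y.val * A) + (H.val * B - B * H.val))
      (h3 : (-1 : ℝ) • A = (B * Z.val - Z.val * B) + (Y.val * C - C * Y.val)) :
      a • B + b • A + c • C =
      !![C 0 1 / 2, A 1 0 / 2 - A 0 1 / 2 - A 1 0 / 2; A 1 0 / 2, -(C 0 1 / 2)] *
        !![b, c - a; a, -b] - !![b, c - a; a, -b] *
      !![C 0 1 / 2, A 1 0 / 2 - A 0 1 / 2 - A 1 0 / 2; A 1 0 / 2, -(C 0 1 / 2)] := by
    rw [val_H, val_Z, ← Matrix.ext_iff] at h1
    rw [val_H, val_Y, ← Matrix.ext_iff] at h2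
    rw [val_Y, val_Z, ← Matrix.ext_iff] at h3
    simp only [Fin.forall_fin_two, Matrix.sub_apply, Matrix.add_apply, Matrix.smul_apply,
      Matrix.mul_apply, Fin.sum_univ_two] at h1 h2 h3
    simp at h1 h2 h3
    ext i j
    simp only [Matrix.sub_apply, Matrix.add_apply, Matrix.smul_apply,
      Matrix.mul_apply, Fin.sum_univ_two]
    obtain ⟨⟨p1, p2⟩, p3, p4⟩ := h1
    obtain ⟨⟨q1, q2⟩, q3, q4⟩ := h2
    obtain ⟨⟨r1, r2⟩, r3, r4⟩ := h3
    have hA0 : A 0 0 = 0 := by linarith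
    have hC0 : C 0 0 = -(A 1 0 / 2) := by linarith
    have hC1 : C 1 0 = 0 := by linarith
    have hB0 : B 0 0 = A 1 0 / 2 - A 0 1 / 2 := by linarith
    have hB1 : B 0 1 = -C 0 1 := by linarith
    have hB2 : B 1 0 = -C 0 1 := by linarith
    fin_cases i <;> fin_cases j <;> simp [hA, hB, hC, hA0, hC0, hC1, hB0, hB1, hB2] <;> ring
  intro W
  rw [eq_combination W, val_combination, ← key _ _ _ _ _ _ hH hY hZ h1 h2 h3, ← val_combination]
  change D (_ • Y.val + _ • H.val + _ • Z.val) = _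
  simp only [map_add, map_smul]

lemma eq_of_forall_commutator_eq {X X' : sl2}
    (h : ∀ W : sl2, X.val * W.val - W.val * X.val = X'.val * W.val - W.val * X'.val) :
    X = X' := by
  have h1 := h H
  have h2 := h Z
  have hX := sl2_apply_one_one X
  have hX' := sl2_apply_one_one X'
  rw [val_H, ← Matrix.ext_iff] at h1
  rw [val_Z, ← Matrix.ext_iff] at h2
  simp only [Fin.forall_fin_two, Matrix.sub_apply, Matrix.mul_apply, Fin.sum_univ_two] at h1 h2
  simp at h1 h2
  apply Subtype.ext
  ext i j
  fin_cases i <;> fin_cases j <;> simp <;> linarith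

/-! ### The associated right-invariant vector field -/

lemma isMultiplicative_commutator (X : Mat2) :
    IsMultiplicative fun g => X * g.val - g.val * X := by
  intro g h
  simp only [Matrix.SpecialLinearGroup.coe_mul]
  noncomm_ring

lemma differential_rightInv (X W : sl2) (g : SL2) :
    differential (rightInv X) g (W.val * g.val) = X.val * (W.val * g.val) := by
  have h1 := (isSmooth_rightInv X).hasDerivAt_comp (hasDerivAt_curve_mul W g)
  have h2 := hasDerivAt_const_mul X.val (hasDerivAt_curve_mul W g)
  simpa [curve_zero] using h1.unique h2

lemma bracket_rightInv (X W : sl2) (g : SL2) :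
    bracket (rightInv X) (rightInv W) g = -(X.val * W.val - W.val * X.val) * g.val := by
  rw [bracket_apply, rightInv, rightInv, differential_rightInv, differential_rightInv]
  noncomm_ring

/-- The flow line through `g` serves as test curve with velocity `F g`. -/
lemma IsFlow.differential_rightInv {F : SL2 → Mat2} {φ : ℝ → SL2 → SL2} (hφ : IsFlow F φ)
    (W : sl2) (g : SL2) : differential (rightInv W) g (F g) = W.val * F g := by
  have h1 := (isSmooth_rightInv W).hasDerivAt_comp (hφ.hasDerivAt_zero g)
  have h2 := hasDerivAt_const_mul W.val (hφ.hasDerivAt_zero g)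
  simpa [hφ.1] using h1.unique h2

lemma derivation_apply {F : SL2 → Mat2} (hF : IsLinearVectorField F) (W : sl2) (g : SL2) :
    derivation F W g = differential F 1 W.val * g.val := by
  have hm := hF.isMultiplicative
  obtain ⟨hv, φ, hφ, -⟩ := hF
  rw [derivation, bracket_apply, hφ.differential_rightInv, rightInv, hm.differential_mul hv.1]
  abel

lemma isAssociated_iff {F : SL2 → Mat2} (hF : IsLinearVectorField F) (X : sl2) :
    IsAssociated F X ↔
      ∀ W : sl2, differential F 1 W.val = X.val * W.val - W.val * X.val := by
  simp only [IsAssociated, derivation_apply hF, bracket_rightInv]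
  constructor
  · intro h W
    simpa using h W 1
  · intro h W g
    rw [h W, neg_mul, neg_neg]

lemma existsUnique_isAssociated {F : SL2 → Mat2} (hF : IsLinearVectorField F) :
    ∃! X : sl2, IsAssociated F X := by
  have hm := hF.isMultiplicative
  obtain ⟨X, hX⟩ := exists_forall_eq_commutator (differential F 1).toLinearMap
    (hm.differential_one_mem hF.1) (hm.differential_one_commutator hF.1.1)
  refine ⟨X, (isAssociated_iff hF X).2 hX, fun X' hX' => ?_⟩
  replace hX' := (isAssociated_iff hF X').1 hX'
  exact eq_of_forall_commutator_eq fun W => (hX' W).symm.trans (hX W)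

lemma existsUnique_coordinates {F : SL2 → Mat2} (hF : IsLinearVectorField F) :
    ∃! p : ℝ × ℝ × ℝ, IsAssociated F (p.1 • Y + p.2.1 • H + p.2.2 • Z) := by
  obtain ⟨X, hX, hu⟩ := existsUnique_isAssociated hF
  refine ⟨(X.val 1 0, X.val 0 0, X.val 0 1 + X.val 1 0), ?_, ?_⟩
  · change IsAssociated F (X.val 1 0 • Y + X.val 0 0 • H + (X.val 0 1 + X.val 1 0) • Z)
    rwa [← eq_combination]
  · rintro ⟨a, b, c⟩ h
    have := hu _ h
    rw [← this, val_combination]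
    simp

/-! ### The vector field is determined by the associated element -/

/-- The upper unipotent one-parameter subgroup. -/
def upper (s : ℝ) : SL2 := ⟨!![1, s; 0, 1], by simp [Matrix.det_fin_two_of]⟩

/-- The lower unipotent one-parameter subgroup. -/
def lower (s : ℝ) : SL2 := ⟨!![1, 0; s, 1], by simp [Matrix.det_fin_two_of]⟩

lemma val_upper (s : ℝ) : (upper s).val = !![1, s; 0, 1] := rfl

lemma val_lower (s : ℝ) : (lower s).val = !![1, 0; s, 1] := rfl

lemma upper_add (s t : ℝ) : upper (s + t) = upper s * upper t := by
  ext i j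
  fin_cases i <;> fin_cases j <;> simp [val_upper, add_comm]

lemma lower_add (s t : ℝ) : lower (s + t) = lower s * lower t := by
  ext i j
  fin_cases i <;> fin_cases j <;> simp [val_lower]

lemma upper_zero : upper 0 = 1 := by
  ext i j
  fin_cases i <;> fin_cases j <;> simp [val_upper]

lemma lower_zero : lower 0 = 1 := by
  ext i j
  fin_cases i <;> fin_cases j <;> simp [val_lower]

lemma hasDerivAt_upper : HasDerivAt (fun s => (upper s).val) Z.val 0 := by
  refine hasDerivAt_matrix fun i j => ?_
  fin_cases i <;> fin_cases j <;> simp [val_upper, val_Z, hasDerivAt_const]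
  exact hasDerivAt_id _

lemma hasDerivAt_lower : HasDerivAt (fun s => (lower s).val) (Y + Z).val 0 := by
  refine hasDerivAt_matrix fun i j => ?_
  fin_cases i <;> fin_cases j <;> simp [val_lower, val_Z, val_Y, hasDerivAt_const]
  exact hasDerivAt_id _

lemma eq_upper_mul_lower_mul_upper {g : SL2} (hg : g.val 1 0 ≠ 0) :
    g = upper ((g.val 0 0 - 1) / g.val 1 0) * lower (g.val 1 0) *
      upper ((g.val 1 1 - 1) / g.val 1 0) := by
  have hdet := g.2
  rw [Matrix.det_fin_two] at hdet
  ext i j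
  fin_cases i <;> fin_cases j <;> simp [val_upper, val_lower] <;> field_simp
  · ring
  · linear_combination -hdet
  · ring

lemma induction_upper_lower {p : SL2 → Prop} (hmul : ∀ g h, p g → p h → p (g * h))
    (hu : ∀ s, p (upper s)) (hl : ∀ s, p (lower s)) (g : SL2) : p g := by
  have key (h : SL2) (hh : h.val 1 0 ≠ 0) : p h := by
    rw [eq_upper_mul_lower_mul_upper hh]
    exact hmul _ _ (hmul _ _ (hu _) (hl _)) (hu _)
  by_cases hg : g.val 1 0 = 0
  · have hdet := g.2
    rw [Matrix.det_fin_two, hg] at hdet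
    -- The factorization in `key` needs a nonzero lower left entry; multiplying by `lower 1` turns
    -- that entry into `g 0 0`, which is nonzero by the determinant.
    have h1 : g = lower (-1) * (lower 1 * g) := by
      rw [← mul_assoc, ← lower_add]
      simp [lower_zero]
    rw [h1]
    refine hmul _ _ (hl _) (key _ ?_)
    have h2 : g.val 0 0 ≠ 0 := by
      rintro h
      simp [h] at hdet
    simpa [val_lower, Matrix.mul_apply, Fin.sum_univ_two, hg, -Matrix.cons_mul] using h2
  · exact key g hg

/-- By the cocycle identity, the derivative of `K (γ r) * (γ r)⁻¹` at any `r` is a conjugate of its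
derivative at `0`, hence zero; so this function is constant. -/
lemma IsMultiplicative.eq_zero_of_hasDerivAt {K : SL2 → Mat2} (hK : IsMultiplicative K)
    {γ : ℝ → SL2} (hγ : ∀ s t, γ (s + t) = γ s * γ t) (hγ0 : γ 0 = 1) {v : Mat2}
    (hv : HasDerivAt (fun s => (γ s).val) v 0) (hd : HasDerivAt (fun s => K (γ s)) 0 0) (s : ℝ) :
    K (γ s) = 0 := by
  have hi := hasDerivAt_inv hv
  have hz : HasDerivAt (fun r => K (γ r) * ((γ r)⁻¹).val) 0 0 := by
    simpa [hγ0, hK.apply_one] using hasDerivAt_mul hd hi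
  have hstep (r t : ℝ) : K (γ (r + t)) * ((γ (r + t))⁻¹).val =
      K (γ r) * ((γ r)⁻¹).val + (γ r).val * (K (γ t) * ((γ t)⁻¹).val) * ((γ r)⁻¹).val := by
    have h1 : (γ t).val * ((γ t)⁻¹).val = 1 := by
      rw [← Matrix.SpecialLinearGroup.coe_mul, mul_inv_cancel, Matrix.SpecialLinearGroup.coe_one]
    rw [hγ, hK, mul_inv_rev, Matrix.SpecialLinearGroup.coe_mul, add_mul, mul_assoc (K (γ r)),
      ← mul_assoc (γ t).val, h1, one_mul]
    simp only [mul_assoc]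
  have hall (r : ℝ) : HasDerivAt (fun t => K (γ t) * ((γ t)⁻¹).val) 0 r := by
    have h1 := hasDerivAt_add (hasDerivAt_const (0 : ℝ) (K (γ r) * ((γ r)⁻¹).val))
      (hasDerivAt_mul_const (hasDerivAt_const_mul (γ r).val hz) ((γ r)⁻¹).val)
    simp only [← hstep] at h1
    have h2 : HasDerivAt (fun t => K (γ (r + t)) * ((γ (r + t))⁻¹).val) 0 (r - r) := by
      simpa using h1
    have h3 := h2.comp_sub_const r r
    simp only [add_sub_cancel] at h3
    exact h3
  have hconst := is_const_of_deriv_eq_zero (fun r => (hall r).differentiableAt)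
    (fun r => (hall r).deriv) s 0
  simp only [hγ0, hK.apply_one, zero_mul] at hconst
  have h1 : ((γ s)⁻¹).val * (γ s).val = 1 := by
    rw [← Matrix.SpecialLinearGroup.coe_mul, inv_mul_cancel, Matrix.SpecialLinearGroup.coe_one]
  calc K (γ s) = K (γ s) * ((γ s)⁻¹).val * (γ s).val := by rw [mul_assoc, h1, mul_one]
    _ = 0 := by rw [hconst, zero_mul]

lemma IsAssociated.eq_commutator {F : SL2 → Mat2} {X : sl2} (hX : IsAssociated F X)
    (hF : IsLinearVectorField F) (g : SL2) : F g = X.val * g.val - g.val * X.val := by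
  rw [isAssociated_iff hF] at hX
  have hm : IsMultiplicative fun g => F g - (X.val * g.val - g.val * X.val) := by
    intro g h
    have h1 := isMultiplicative_commutator X.val g h
    simp only at h1 ⊢
    rw [hF.isMultiplicative, h1]
    noncomm_ring
  have hd {γ : ℝ → SL2} (hγ0 : γ 0 = 1) {W : sl2}
      (hv : HasDerivAt (fun s => (γ s).val) W.val 0) :
      HasDerivAt (fun s => F (γ s) - (X.val * (γ s).val - (γ s).val * X.val)) 0 0 := by
    have h1 := hF.1.1.hasDerivAt_comp hv
    rw [hγ0, hX] at h1
    exact (HasDerivAt.sub h1 (HasDerivAt.sub (hasDerivAt_const_mul X.val hv)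
      (hasDerivAt_mul_const hv X.val))).congr_deriv (sub_self _)
  suffices F g - (X.val * g.val - g.val * X.val) = 0 from sub_eq_zero.1 this
  refine induction_upper_lower (p := fun g => F g - (X.val * g.val - g.val * X.val) = 0)
    (fun g h hg hh => ?_) ?_ ?_ g
  · have := hm g h
    simp only [hg, hh, zero_mul, mul_zero, add_zero] at this
    exact this
  · exact hm.eq_zero_of_hasDerivAt upper_add upper_zero hasDerivAt_upper
      (hd upper_zero hasDerivAt_upper)
  · exact hm.eq_zero_of_hasDerivAt lower_add lower_zero hasDerivAt_lower
      (hd lower_zero hasDerivAt_lower)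

/-! ### Periodicity in the elliptic case -/

/-- The one-parameter group generated by a matrix `X` with `X * X = -θ ^ 2`. -/
noncomputable def rotation (X : Mat2) (θ t : ℝ) : Mat2 :=
  Real.cos (θ * t) • (1 : Mat2) + (Real.sin (θ * t) / θ) • X

lemma rotation_neg_mul_rotation {X : Mat2} {θ : ℝ} (hθ : θ ≠ 0)
    (hX : X * X = -(θ ^ 2) • (1 : Mat2)) (t : ℝ) :
    rotation X θ (-t) * rotation X θ t = 1 := by
  have h := Real.cos_sq_add_sin_sq (θ * t)
  have h1 : rotation X θ (-t) * rotation X θ t =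
      (Real.cos (θ * t) ^ 2) • (1 : Mat2) - (Real.sin (θ * t) / θ) ^ 2 • (X * X) := by
    simp only [rotation, mul_neg, Real.cos_neg, Real.sin_neg, add_mul, mul_add, smul_mul_assoc,
      mul_smul_comm, one_mul, mul_one, neg_div, neg_smul, neg_mul]
    module
  rw [h1, hX, smul_smul, ← sub_smul]
  have h2 : Real.cos (θ * t) ^ 2 - (Real.sin (θ * t) / θ) ^ 2 * -θ ^ 2 = 1 := by
    field_simp
    linarith
  rw [h2, one_smul]

lemma hasDerivAt_rotation {X : Mat2} {θ : ℝ} (hθ : θ ≠ 0)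
    (hX : X * X = -(θ ^ 2) • (1 : Mat2)) (t : ℝ) :
    HasDerivAt (rotation X θ) (X * rotation X θ t) t := by
  have hl : HasDerivAt (fun s : ℝ => θ * s) θ t := by
    simpa using (hasDerivAt_id t).const_mul θ
  refine (HasDerivAt.add (hl.cos.smul_const (1 : Mat2))
    ((hl.sin.div_const θ).smul_const X)).congr_deriv ?_
  rw [rotation, mul_add, mul_smul_comm, mul_smul_comm, hX, mul_one]
  have h1 : Real.cos (θ * t) * θ / θ = Real.cos (θ * t) := by field_simp
  have h2 : Real.sin (θ * t) / θ * -θ ^ 2 = -Real.sin (θ * t) * θ := by field_simp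
  rw [smul_smul, h1, h2, add_comm]

lemma rotation_zero (X : Mat2) (θ : ℝ) : rotation X θ 0 = 1 := by
  simp [rotation]

lemma rotation_add_period (X : Mat2) {θ : ℝ} (hθ : θ ≠ 0) (t : ℝ) :
    rotation X θ (t + 2 * Real.pi / θ) = rotation X θ t := by
  have h : θ * (t + 2 * Real.pi / θ) = θ * t + 2 * Real.pi := by field_simp
  rw [rotation, h, Real.cos_add_two_pi, Real.sin_add_two_pi, rotation]

lemma commute_rotation (X : Mat2) (θ t : ℝ) : X * rotation X θ t = rotation X θ t * X := by
  simp [rotation, mul_add, add_mul]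

/-- Undoing the conjugation turns the solution into a curve with zero derivative, which gives
uniqueness for the equation by hand. -/
lemma eq_rotation_conj {X : Mat2} {θ : ℝ} (hθ : θ ≠ 0) (hX : X * X = -(θ ^ 2) • (1 : Mat2))
    {x : ℝ → Mat2} (hx : ∀ t, HasDerivAt x (X * x t - x t * X) t) (t : ℝ) :
    x t = rotation X θ t * x 0 * rotation X θ (-t) := by
  have hR := hasDerivAt_rotation hθ hX
  have hR' (s : ℝ) : HasDerivAt (fun r => rotation X θ (-r)) (-(X * rotation X θ (-s))) s := by
    exact ((hR (-s)).scomp s (hasDerivAt_neg s)).congr_deriv (by simp)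
  have hz (s : ℝ) : HasDerivAt (fun r => rotation X θ (-r) * x r * rotation X θ r) 0 s := by
    refine (hasDerivAt_mul (hasDerivAt_mul (hR' s) (hx s)) (hR s)).congr_deriv ?_
    rw [commute_rotation]
    noncomm_ring
  have hconst := is_const_of_deriv_eq_zero (fun r => (hz r).differentiableAt)
    (fun r => (hz r).deriv) t 0
  simp only [neg_zero, rotation_zero, one_mul, mul_one] at hconst
  have h1 := rotation_neg_mul_rotation hθ hX (-t)
  rw [neg_neg] at h1
  rw [← hconst]
  calc x t = (rotation X θ t * rotation X θ (-t)) * x t *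
        (rotation X θ t * rotation X θ (-t)) := by rw [h1, one_mul, mul_one]
    _ = _ := by simp only [mul_assoc]

lemma add_period_eq {X : Mat2} {θ : ℝ} (hθ : 0 < θ) (hX : X * X = -(θ ^ 2) • (1 : Mat2))
    {x : ℝ → Mat2} (hx : ∀ t, HasDerivAt x (X * x t - x t * X) t) (t : ℝ) :
    x (t + 2 * Real.pi / θ) = x t := by
  rw [eq_rotation_conj hθ.ne' hX hx, eq_rotation_conj hθ.ne' hX hx t, rotation_add_period X hθ.ne']
  congr 1
  -- The right factor runs backwards in time, so one period is added to `-(t + 2π / θ)` to reach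
  -- `-t`.
  rw [← rotation_add_period X hθ.ne' (-(t + 2 * Real.pi / θ))]
  congr 1
  ring

lemma val_mul_val_combination (a b c : ℝ) :
    (a • Y + b • H + c • Z).val * (a • Y + b • H + c • Z).val =
      (b ^ 2 + a * c - a ^ 2) • (1 : Mat2) := by
  rw [val_combination]
  ext i j
  fin_cases i <;> fin_cases j <;> simp <;> ring

/-! ### Eigenvalues -/

/-- Coordinates on `sl(2, ℝ)`. -/
def coordinates : sl2 ≃ₗ[ℝ] (Fin 3 → ℝ) where
  toFun W := ![W.val 1 0, W.val 0 0, W.val 0 1 + W.val 1 0]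
  invFun v := v 0 • Y + v 1 • H + v 2 • Z
  map_add' V W := by
    ext i
    fin_cases i <;> simp
    ring
  map_smul' r W := by
    ext i
    fin_cases i <;> simp
    ring
  left_inv W := by simpa using (eq_combination W).symm
  right_inv v := by
    simp only [val_combination]
    ext i
    fin_cases i <;> simp

lemma coordinates_apply (W : sl2) :
    coordinates W = ![W.val 1 0, W.val 0 0, W.val 0 1 + W.val 1 0] := rfl

/-- The Iwasawa basis `Y, H, Z` of `sl(2, ℝ)`. -/
noncomputable def basis : Module.Basis (Fin 3) ℝ sl2 := Module.Basis.ofEquivFun coordinates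

lemma basis_eq (v : Fin 3 → sl2) (hv : v = ![Y, H, Z]) (i : Fin 3) : basis i = v i := by
  subst hv
  rw [basis, Module.Basis.coe_ofEquivFun, LinearEquiv.symm_apply_eq]
  ext j
  fin_cases i <;> fin_cases j <;> simp [coordinates, val_Y, val_H, val_Z]

lemma toMatrix_neg_ad (a b c : ℝ) :
    LinearMap.toMatrix basis basis (-(LieAlgebra.ad ℝ sl2 (a • Y + b • H + c • Z))) =
      !![2 * b, -2 * a, 0; -c, 0, a; 4 * b, 2 * c - 4 * a, -2 * b] := by
  have hval (W : sl2) : ((-(LieAlgebra.ad ℝ sl2 (a • Y + b • H + c • Z))) W).val =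
      -(!![b, c - a; a, -b] * W.val - W.val * !![b, c - a; a, -b]) := by
    rw [← val_combination]
    rfl
  ext i j
  rw [LinearMap.toMatrix_apply, basis_eq _ rfl j, basis, Module.Basis.ofEquivFun_repr_apply,
    coordinates_apply, hval]
  fin_cases i <;> fin_cases j <;>
    simp [val_Y, val_H, val_Z] <;> ring

lemma charpoly_neg_ad (a b c : ℝ) :
    (-(LieAlgebra.ad ℝ sl2 (a • Y + b • H + c • Z))).charpoly =
      Polynomial.X ^ 3 - Polynomial.C (4 * (b ^ 2 + a * c - a ^ 2)) * Polynomial.X := by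
  rw [← LinearMap.charpoly_toMatrix _ basis, toMatrix_neg_ad, Matrix.charpoly, Matrix.det_fin_three]
  simp [Polynomial.C_ofNat]
  ring

/-- Any complex square root `s` is allowed because the radicand may be negative; the root set is
symmetric under sign, so neither the choice of `s` nor the sign convention of the bracket matters.
-/
lemma isComplexEigenvalue_iff (a b c : ℝ) (s : ℂ)
    (hs : s ^ 2 = ((b ^ 2 + a * c - a ^ 2 : ℝ) : ℂ)) (μ : ℂ) :
    IsComplexEigenvalue (-(LieAlgebra.ad ℝ sl2 (a • Y + b • H + c • Z))) μ ↔
      μ = 0 ∨ μ = 2 * s ∨ μ = -(2 * s) := by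
  rw [IsComplexEigenvalue, Module.End.hasEigenvalue_iff_isRoot_charpoly,
    LinearMap.charpoly_baseChange, charpoly_neg_ad, Polynomial.IsRoot]
  have h : Polynomial.eval μ ((Polynomial.X ^ 3 - Polynomial.C (4 * (b ^ 2 + a * c - a ^ 2)) *
      Polynomial.X : Polynomial ℝ).map (algebraMap ℝ ℂ)) = μ * ((μ - 2 * s) * (μ + 2 * s)) := by
    push_cast at hs
    simp
    linear_combination 4 * μ * hs
  rw [h, mul_eq_zero, mul_eq_zero, sub_eq_zero, add_eq_zero_iff_eq_neg]

end SL2Linear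

theorem mainTheorem6 (F : SL2Linear.SL2 → SL2Linear.Mat2)
    (hF : SL2Linear.IsLinearVectorField F)
    (φ : ℝ → SL2Linear.SL2 → SL2Linear.SL2) (hφ : SL2Linear.IsFlow F φ) :
    (∃! p : ℝ × ℝ × ℝ, SL2Linear.IsAssociated F
      (p.1 • SL2Linear.Y + p.2.1 • SL2Linear.H + p.2.2 • SL2Linear.Z)) ∧
    ∀ (a b c : ℝ) (X : SL2Linear.sl2),
      X = a • SL2Linear.Y + b • SL2Linear.H + c • SL2Linear.Z →
      SL2Linear.IsAssociated F X →
        (∀ s : ℂ, s ^ 2 = ((b ^ 2 + a * c - a ^ 2 : ℝ) : ℂ) → ∀ μ : ℂ,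
          SL2Linear.IsComplexEigenvalue (-(LieAlgebra.ad ℝ SL2Linear.sl2 X)) μ ↔
            μ = 0 ∨ μ = 2 * s ∨ μ = -(2 * s)) ∧
        (a ^ 2 > a * c + b ^ 2 → ∀ g : SL2Linear.SL2, (¬ ∀ t, φ t g = g) →
          ∃ T : ℝ, 0 < T ∧ ∀ t, φ (t + T) g = φ t g) := by
  refine ⟨SL2Linear.existsUnique_coordinates hF, ?_⟩
  rintro a b c X rfl hX
  refine ⟨SL2Linear.isComplexEigenvalue_iff a b c, fun hlt g _ => ?_⟩
  have hpos : 0 < a ^ 2 - a * c - b ^ 2 := by linarith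
  have hθ := Real.sqrt_pos.2 hpos
  refine ⟨2 * Real.pi / √(a ^ 2 - a * c - b ^ 2), by positivity, fun t => ?_⟩
  refine Subtype.ext (SL2Linear.add_period_eq (X := (a • SL2Linear.Y + b • SL2Linear.H + c • SL2Linear.Z).val)
    (x := fun s => (φ s g).val) hθ ?_ (fun r => ?_) t)
  · rw [SL2Linear.val_mul_val_combination, Real.sq_sqrt hpos.le]
    congr 1
    ring
  -- Only the differential equation for `φ` is needed here, so any flow of `F` will do.
  · rw [← hX.eq_commutator hF]
    exact hφ.2 g r
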